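/- Let \(A,B\) be \(n\times n\) complex positive definite matrices and let \(a,b\ge 0\) be real. Let \[ A\#B=A^{1/2}\bigl(A^{-1/2}BA^{-1/2}\bigr)^{1/2}A^{1/2} \] be the Kubo-Ando geometric mean, and put \[ H^{\#}_{a,b}(A,B)=a^2A+b^2B+2ab\,(A\#B),\qquad W_{a,b}(A,B)=a^2A+b^2B+ab\bigl((AB)^{1/2}+(BA)^{1/2}\bigr), \] where \((AB)^{1/2}\) and \((BA)^{1/2}\) are the principal square roots (the square roots with spectrum in the open right half-plane). These two matrices are Hermitian. For a Hermitian matrix \(T\), let \(\lambda(T)\in\mathbb R^n\) be the vector of its eigenvalues, counted with multiplicity and in decreasing order. For \(x,y\in\mathbb R^n\), write \(x\prec_w y\) if \(\sum_{j=1}^k x_j^{\downarrow}\le\sum_{j=1}^k y_j^{\downarrow}\) for every \(1\le k\le n\), where \(x^{\downarrow}\) is the decreasing rearrangement of \(x\). Then \[ \lambda\bigl(H^{\#}_{a,b}(A,B)\bigr)\prec_w\lambda\bigl(W_{a,b}(A,B)\bigr). \] Consequently, for every unitarily invariant norm \(|||\cdot|||\) on the complex \(n\times n\) matrices (that is, every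 norm with \(|||UXV|||=|||X|||\) for all matrices \(X\) and all unitary \(U,V\)), \[ |||H^{\#}_{a,b}(A,B)|||\le|||W_{a,b}(A,B)|||. \] -/

import Mathlib

open scoped ComplexOrder MatrixOrder

noncomputable section

namespace HeronWasserstein

variable {n : ℕ}

/-- The decreasing rearrangement `x↓` of a real vector. -/
def decreasingRearrangement (x : Fin n → ℝ) : Fin n → ℝ :=
  x ∘ Tuple.sort (fun i => -x i)

theorem decreasingRearrangement_antitone (x : Fin n → ℝ) :
    Antitone (decreasingRearrangement x) := fun _ _ h =>
  neg_le_neg_iff.mp (Tuple.monotone_sort (fun i => -x i) h)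

/-- Weak majorization `x ≺_w y`: for `1 ≤ k ≤ n`, the sum of the `k` largest entries of `x` is at
most the sum of the `k` largest entries of `y`. -/
def WeaklyMajorizedBy (x y : Fin n → ℝ) : Prop :=
  ∀ k : ℕ, 1 ≤ k → k ≤ n →
    ∑ j : Fin n with j.val < k, decreasingRearrangement x j ≤
      ∑ j : Fin n with j.val < k, decreasingRearrangement y j

/-- The vector `λ(T)` of eigenvalues of a Hermitian matrix, with multiplicity, in decreasing
order. -/
def eigenvalueVector {T : Matrix (Fin n) (Fin n) ℂ} (hT : T.IsHermitian) : Fin n → ℝ :=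
  fun j => hT.eigenvalues₀ (Fin.cast (Fintype.card_fin n).symm j)

/-- The Kubo-Ando geometric mean `A # B = A^{1/2} (A^{-1/2} B A^{-1/2})^{1/2} A^{1/2}`
of positive definite matrices. -/
def geometricMean (A B : Matrix (Fin n) (Fin n) ℂ) : Matrix (Fin n) (Fin n) ℂ :=
  CFC.sqrt A * CFC.sqrt ((CFC.sqrt A)⁻¹ * B * (CFC.sqrt A)⁻¹) * CFC.sqrt A

/-- `Y` is a principal square root of `M`: a square root all of whose eigenvalues lie in the open
right half-plane. -/
def IsPrincipalSqrt (Y M : Matrix (Fin n) (Fin n) ℂ) : Prop :=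
  Y * Y = M ∧ ∀ z ∈ spectrum ℂ Y, 0 < z.re

/-- A matrix has at most one principal square root. -/
theorem IsPrincipalSqrt.unique {Y Z M : Matrix (Fin n) (Fin n) ℂ}
    (hY : IsPrincipalSqrt Y M) (hZ : IsPrincipalSqrt Z M) : Y = Z := by
  rcases subsingleton_or_nontrivial (Matrix (Fin n) (Fin n) ℂ) with h | h
  · exact Subsingleton.elim _ _
  have hD : Y * (Y - Z) = (Y - Z) * (-Z) := by
    rw [mul_sub, sub_mul, mul_neg, mul_neg, hY.1, hZ.1]
    abel
  have hp : ∀ p : Polynomial ℂ,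
      Polynomial.aeval Y p * (Y - Z) = (Y - Z) * Polynomial.aeval (-Z) p := by
    intro p
    induction p using Polynomial.induction_on with
    | C c => simp [Algebra.commutes]
    | add p q hp hq => simp only [map_add, add_mul, mul_add, hp, hq]
    | monomial k c ih =>
      rw [pow_succ, ← mul_assoc, map_mul, Polynomial.aeval_X, mul_assoc, hD, ← mul_assoc, ih,
        map_mul _ _ (Polynomial.X : Polynomial ℂ), Polynomial.aeval_X, mul_assoc]
  have h0 := hp Y.charpoly
  rw [Matrix.aeval_self_charpoly, zero_mul] at h0
  have hu : IsUnit (Polynomial.aeval (-Z) Y.charpoly) := by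
    rw [← spectrum.zero_notMem_iff ℂ, spectrum.map_polynomial_aeval_of_nonempty _ _
      (spectrum.nonempty_of_isAlgClosed_of_finiteDimensional ℂ (-Z))]
    rintro ⟨k, hk, hk0⟩
    have h1 := hY.2 k (Matrix.mem_spectrum_iff_isRoot_charpoly.mpr hk0)
    have h2 := hZ.2 (-k) (by rw [← spectrum.neg_eq] at hk; simpa using hk)
    simp only [Complex.neg_re] at h2
    linarith
  exact sub_eq_zero.mp ((hu.mul_left_eq_zero).mp h0.symm)

open Classical in
/-- The principal square root `M^{1/2}` (and `0` if `M` has none). -/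
def principalSqrt (M : Matrix (Fin n) (Fin n) ℂ) : Matrix (Fin n) (Fin n) ℂ :=
  if h : ∃ Y, IsPrincipalSqrt Y M then h.choose else 0

/-- The product of two positive definite matrices has a principal square root. -/
theorem isPrincipalSqrt_principalSqrt_mul {A B : Matrix (Fin n) (Fin n) ℂ}
    (hA : A.PosDef) (hB : B.PosDef) : IsPrincipalSqrt (principalSqrt (A * B)) (A * B) := by
  have hsq : ∀ P : Matrix (Fin n) (Fin n) ℂ, P.PosDef → (CFC.sqrt P).PosDef := fun P hP =>
    (Matrix.nonneg_iff_posSemidef.mp (CFC.sqrt_nonneg P)).posDef_iff_isUnit.mpr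
      (CFC.isUnit_sqrt_iff P hP.posSemidef.nonneg |>.mpr hP.isUnit)
  have hex : ∃ Y, IsPrincipalSqrt Y (A * B) := by
    have hS : (CFC.sqrt A).PosDef := hsq A hA
    obtain ⟨u, hu⟩ := hS.isUnit
    have huA : (u : Matrix (Fin n) (Fin n) ℂ) * u = A := by
      rw [hu, CFC.sqrt_mul_sqrt_self A hA.posSemidef.nonneg]
    have hC : ((u : Matrix (Fin n) (Fin n) ℂ) * B * u).PosDef := by
      have := hB.mul_mul_conjTranspose_same (B := (u : Matrix (Fin n) (Fin n) ℂ))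
        (Matrix.vecMul_injective_of_isUnit u.isUnit)
      rwa [hu, hS.isHermitian.eq, ← hu] at this
    have hQ : (CFC.sqrt ((u : Matrix (Fin n) (Fin n) ℂ) * B * u)).PosDef := hsq _ hC
    have hQQ := CFC.sqrt_mul_sqrt_self _ hC.posSemidef.nonneg
    generalize CFC.sqrt ((u : Matrix (Fin n) (Fin n) ℂ) * B * u) = Q at hQ hQQ
    refine ⟨u * Q * ((u⁻¹ : (Matrix (Fin n) (Fin n) ℂ)ˣ) : Matrix (Fin n) (Fin n) ℂ), ?_, ?_⟩
    · calc _ = (u : Matrix (Fin n) (Fin n) ℂ) * (Q * Q) *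
              ((u⁻¹ : (Matrix (Fin n) (Fin n) ℂ)ˣ) : Matrix (Fin n) (Fin n) ℂ) := by
            simp [mul_assoc]
        _ = A * B := by rw [hQQ, ← huA]; simp [mul_assoc]
    · rw [spectrum.units_conjugate]
      intro z hz
      rw [hQ.isHermitian.spectrum_eq_image_range] at hz
      obtain ⟨_, ⟨i, rfl⟩, rfl⟩ := hz
      simpa using hQ.eigenvalues_pos i
  rw [principalSqrt, dif_pos hex]
  exact hex.choose_spec

/-- The Kubo-Ando Heron expression `a²A + b²B + 2ab (A # B)`. -/
def heron (a b : ℝ) (A B : Matrix (Fin n) (Fin n) ℂ) : Matrix (Fin n) (Fin n) ℂ :=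
  a ^ 2 • A + b ^ 2 • B + (2 * a * b) • geometricMean A B

/-- The weighted Bures-Wasserstein expression `a²A + b²B + ab ((AB)^{1/2} + (BA)^{1/2})`. -/
def wasserstein (a b : ℝ) (A B : Matrix (Fin n) (Fin n) ℂ) : Matrix (Fin n) (Fin n) ℂ :=
  a ^ 2 • A + b ^ 2 • B + (a * b) • (principalSqrt (A * B) + principalSqrt (B * A))

/-- A norm on the complex `n × n` matrices (a seminorm that vanishes only at `0`) is unitarily
invariant if `N (U X V) = N X` for all unitary `U`, `V`. -/
structure IsUnitarilyInvariantNorm (N : Seminorm ℂ (Matrix (Fin n) (Fin n) ℂ)) : Prop where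
  eq_zero_of_map_eq_zero : ∀ X, N X = 0 → X = 0
  map_unitary_mul_mul : ∀ U ∈ Matrix.unitaryGroup (Fin n) ℂ, ∀ V ∈ Matrix.unitaryGroup (Fin n) ℂ,
    ∀ X, N (U * X * V) = N X

end HeronWasserstein

end

/-! Put `T = A⁻¹ # B` and `M = a + bT`. Then `B = TAT` and the Wasserstein expression is `W = MAM`
(`exists_wasserstein_eq`). For `X > 0` let `Φ(X)` be the Heron expression of `P = M⁻¹XM⁻¹` and
`TPT`, so that `Φ(W)` is the Heron expression `H` of `A` and `B`. The map `Φ` is monotone because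
the geometric mean is, it fixes positive scalars, and it does not increase the trace
(`trace_geometricMean_le`).

Let `t` be the `k`-th eigenvalue of `W` and let `X` be `W` with its smaller eigenvalues raised to
`t`. Then `Y = Φ(X)` satisfies `Y ≥ H`, `Y ≥ t` and `tr Y ≤ tr X` (`exists_ge_heron`), so the top
`k` eigenvalues of `H` sum to at most `tr X - (n - k)t`, the sum of the top `k` eigenvalues of `W`.
The norm inequality follows by Ky Fan dominance, proved through a supporting functional of the gauge
(`gauge_le_of_partial_sums`). -/

namespace HeronWasserstein

open Matrix

variable {n : ℕ}

/-! ### Operator order on positive definite matrices -/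

section

open scoped Matrix.Norms.L2Operator

/-- The square root is operator monotone. -/
theorem le_of_mul_self_le_mul_self {X Y : Matrix (Fin n) (Fin n) ℂ} (hX : 0 ≤ X) (hY : 0 ≤ Y)
    (h : X * X ≤ Y * Y) : X ≤ Y := by
  have := CFC.sqrt_le_sqrt _ _ h
  rwa [CFC.sqrt_mul_self X hX, CFC.sqrt_mul_self Y hY] at this

end

theorem posDef_sqrt {P : Matrix (Fin n) (Fin n) ℂ} (hP : P.PosDef) : (CFC.sqrt P).PosDef :=
  (Matrix.nonneg_iff_posSemidef.mp (CFC.sqrt_nonneg P)).posDef_iff_isUnit.mpr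
    (CFC.isUnit_sqrt_iff P hP.posSemidef.nonneg |>.mpr hP.isUnit)

theorem sqrt_mul_sqrt {P : Matrix (Fin n) (Fin n) ℂ} (hP : P.PosDef) :
    CFC.sqrt P * CFC.sqrt P = P :=
  CFC.sqrt_mul_sqrt_self P hP.posSemidef.nonneg

theorem posDef_conj {P S : Matrix (Fin n) (Fin n) ℂ} (hP : P.PosDef) (hS : S.PosDef) :
    (S * P * S).PosDef := by
  have := hP.mul_mul_conjTranspose_same (B := S) (Matrix.vecMul_injective_of_isUnit hS.isUnit)
  rwa [hS.isHermitian.eq] at this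

theorem conj_le_conj {P Q S : Matrix (Fin n) (Fin n) ℂ} (h : P ≤ Q) (hS : S.IsHermitian) :
    S * P * S ≤ S * Q * S := by
  rw [Matrix.le_iff] at h ⊢
  have := h.mul_mul_conjTranspose_same S
  rwa [hS.eq, mul_sub, sub_mul] at this

theorem mul_inv_of_posDef {P : Matrix (Fin n) (Fin n) ℂ} (hP : P.PosDef) : P * P⁻¹ = 1 :=
  Matrix.mul_nonsing_inv P ((Matrix.isUnit_iff_isUnit_det P).mp hP.isUnit)

theorem inv_mul_of_posDef {P : Matrix (Fin n) (Fin n) ℂ} (hP : P.PosDef) : P⁻¹ * P = 1 :=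
  Matrix.nonsing_inv_mul P ((Matrix.isUnit_iff_isUnit_det P).mp hP.isUnit)

/-- Inversion is operator antitone. -/
theorem inv_le_inv_of_posDef {P Q : Matrix (Fin n) (Fin n) ℂ} (hP : P.PosDef) (hQ : Q.PosDef)
    (h : P ≤ Q) : Q⁻¹ ≤ P⁻¹ := by
  -- `P⁻¹ - Q⁻¹ = Q⁻¹(Q - P)Q⁻¹ + (P⁻¹ - Q⁻¹)P(P⁻¹ - Q⁻¹)`, a sum of two positive semidefinite
  -- terms.
  have h1 := conj_le_conj h hQ.inv.isHermitian
  have h2 := hP.posSemidef.mul_mul_conjTranspose_same (P⁻¹ - Q⁻¹)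
  rw [(hP.inv.isHermitian.sub hQ.inv.isHermitian).eq] at h2
  rw [Matrix.le_iff] at h1 ⊢
  convert h1.add h2 using 1
  simp only [mul_sub, sub_mul, mul_assoc, mul_inv_of_posDef hP, mul_inv_of_posDef hQ, mul_one]
  simp only [← mul_assoc, inv_mul_of_posDef hP, one_mul]
  abel

/-! ### The geometric mean through its Riccati equation -/

/-- The geometric mean is positive definite. -/
theorem posDef_geometricMean {A B : Matrix (Fin n) (Fin n) ℂ} (hA : A.PosDef) (hB : B.PosDef) :
    (geometricMean A B).PosDef :=
  posDef_conj (posDef_sqrt (posDef_conj hB (posDef_sqrt hA).inv)) (posDef_sqrt hA)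

/-- The geometric mean solves the Riccati equation `G A⁻¹ G = B`. -/
theorem geometricMean_mul_inv_mul {A B : Matrix (Fin n) (Fin n) ℂ} (hA : A.PosDef)
    (hB : B.PosDef) : geometricMean A B * A⁻¹ * geometricMean A B = B := by
  have hS := posDef_sqrt hA
  have hC := sqrt_mul_sqrt (posDef_conj hB hS.inv)
  have hAi : A⁻¹ = (CFC.sqrt A)⁻¹ * (CFC.sqrt A)⁻¹ := by
    rw [← Matrix.mul_inv_rev, sqrt_mul_sqrt hA]
  have h1 := mul_inv_of_posDef hS
  have h2 := inv_mul_of_posDef hS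
  rw [geometricMean, hAi]
  generalize CFC.sqrt A = S at *
  generalize CFC.sqrt (S⁻¹ * B * S⁻¹) = D at *
  calc _ = S * (D * (S * S⁻¹) * (S⁻¹ * S) * D) * S := by simp only [mul_assoc]
    _ = S * S⁻¹ * B := by
      rw [h1, mul_one, mul_assoc D, h2, one_mul, mul_assoc S, hC]
      simp only [mul_assoc, h2, mul_one]
      rw [← mul_assoc S, h1]
    _ = B := by rw [h1, one_mul]

/-- Monotonicity of the solution of the Riccati equation. -/
theorem le_of_riccati {A A' G G' : Matrix (Fin n) (Fin n) ℂ} (hA : A.PosDef) (hA' : A'.PosDef)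
    (hG : G.PosDef) (hG' : G'.PosDef) (h : A ≤ A') (hB : G * A⁻¹ * G ≤ G' * A'⁻¹ * G') :
    G ≤ G' := by
  have h1 := (conj_le_conj (inv_le_inv_of_posDef hA hA' h) hG.isHermitian).trans hB
  have hR := posDef_sqrt hA'.inv
  have hRR := sqrt_mul_sqrt hA'.inv
  generalize CFC.sqrt A'⁻¹ = R at *
  -- Since `R² = A'⁻¹`, conjugating `h1` by `R` gives `(RGR)² ≤ (RG'R)²`, and the square root is
  -- operator monotone.
  have h2 : R * G * R ≤ R * G' * R := by
    refine le_of_mul_self_le_mul_self (posDef_conj hG hR).posSemidef.nonneg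
      (posDef_conj hG' hR).posSemidef.nonneg ?_
    have := conj_le_conj h1 hR.isHermitian
    rw [← hRR] at this
    simpa only [mul_assoc] using this
  have h3 := conj_le_conj h2 hR.inv.isHermitian
  have e : ∀ X, R⁻¹ * (R * X * R) * R⁻¹ = X := fun X => by
    calc _ = (R⁻¹ * R) * X * (R * R⁻¹) := by simp only [mul_assoc]
      _ = X := by rw [mul_inv_of_posDef hR, inv_mul_of_posDef hR, one_mul, mul_one]
  rwa [e, e] at h3

/-- Monotonicity of Riccati solutions, applied in both directions, gives uniqueness. -/
theorem eq_geometricMean_of_riccati {A B G : Matrix (Fin n) (Fin n) ℂ} (hA : A.PosDef)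
    (hB : B.PosDef) (hG : G.PosDef) (h : G * A⁻¹ * G = B) : geometricMean A B = G := by
  have hR := geometricMean_mul_inv_mul hA hB
  exact le_antisymm
    (le_of_riccati hA hA (posDef_geometricMean hA hB) hG le_rfl (hR.trans h.symm).le)
    (le_of_riccati hA hA hG (posDef_geometricMean hA hB) le_rfl (h.trans hR.symm).le)

theorem geometricMean_mono {A A' B B' : Matrix (Fin n) (Fin n) ℂ} (hA : A.PosDef)
    (hA' : A'.PosDef) (hB : B.PosDef) (hB' : B'.PosDef) (h : A ≤ A') (h' : B ≤ B') :
    geometricMean A B ≤ geometricMean A' B' := by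
  refine le_of_riccati hA hA' (posDef_geometricMean hA hB) (posDef_geometricMean hA' hB') h ?_
  rwa [geometricMean_mul_inv_mul hA hB, geometricMean_mul_inv_mul hA' hB']

theorem smul_le_smul_of_nonneg {P Q : Matrix (Fin n) (Fin n) ℂ} (h : P ≤ Q) {c : ℝ}
    (hc : 0 ≤ c) : c • P ≤ c • Q := by
  rw [Matrix.le_iff] at h ⊢
  rw [← smul_sub]
  exact h.smul hc

theorem heron_mono {A A' B B' : Matrix (Fin n) (Fin n) ℂ} (hA : A.PosDef)
    (hA' : A'.PosDef) (hB : B.PosDef) (hB' : B'.PosDef) (h : A ≤ A') (h' : B ≤ B') {a b : ℝ}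
    (ha : 0 ≤ a) (hb : 0 ≤ b) : heron a b A B ≤ heron a b A' B' :=
  add_le_add (add_le_add (smul_le_smul_of_nonneg h (by positivity))
    (smul_le_smul_of_nonneg h' (by positivity)))
    (smul_le_smul_of_nonneg (geometricMean_mono hA hA' hB hB' h h') (by positivity))

theorem isHermitian_real_smul {P : Matrix (Fin n) (Fin n) ℂ} (h : P.IsHermitian) (c : ℝ) :
    (c • P).IsHermitian := by
  rw [Matrix.IsHermitian, Matrix.conjTranspose_smul, h.eq, star_trivial]

theorem isHermitian_heron {A B : Matrix (Fin n) (Fin n) ℂ} (hA : A.PosDef) (hB : B.PosDef)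
    (a b : ℝ) : (heron a b A B).IsHermitian :=
  ((isHermitian_real_smul hA.isHermitian _).add (isHermitian_real_smul hB.isHermitian _)).add
    (isHermitian_real_smul (posDef_geometricMean hA hB).isHermitian _)

/-! ### The trace inequality -/

theorem trace_mul_nonneg {P S : Matrix (Fin n) (Fin n) ℂ} (hP : P.PosSemidef) (hS : S.PosDef) :
    0 ≤ (S * P).trace := by
  rw [← sqrt_mul_sqrt hS, mul_assoc, Matrix.trace_mul_comm]
  have := hP.mul_mul_conjTranspose_same (CFC.sqrt S)
  rw [(posDef_sqrt hS).isHermitian.eq] at this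
  exact this.trace_nonneg

/-- A completed square: with `G` the mean, `(TA - G)A⁻¹(TA - G)ᴴ` is positive semidefinite and, by
the Riccati equation, equals `2TAT - TG - GT`. Its trace against `T⁻¹` is `2(tr TA - tr G)`. -/
theorem trace_geometricMean_le {A T : Matrix (Fin n) (Fin n) ℂ} (hA : A.PosDef) (hT : T.PosDef) :
    (geometricMean A (T * A * T)).trace.re ≤ (T * A).trace.re := by
  have hB := posDef_conj hA hT
  have hG := posDef_geometricMean hA hB
  have hR := geometricMean_mul_inv_mul hA hB
  generalize geometricMean A (T * A * T) = G at *
  have h := hA.inv.posSemidef.mul_mul_conjTranspose_same (T * A - G)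
  have e : (T * A - G) * A⁻¹ * (T * A - G)ᴴ = T * A * T - T * G - G * T + G * A⁻¹ * G := by
    rw [Matrix.conjTranspose_sub, Matrix.conjTranspose_mul, hA.isHermitian.eq, hT.isHermitian.eq,
      hG.isHermitian.eq]
    calc _ = T * (A * A⁻¹) * A * T - T * (A * A⁻¹) * G - G * (A⁻¹ * A) * T + G * A⁻¹ * G := by
          noncomm_ring
      _ = _ := by rw [mul_inv_of_posDef hA, inv_mul_of_posDef hA]; simp only [mul_one]
  rw [e, hR] at h
  have h2 := trace_mul_nonneg h hT.inv
  have e2 : (T⁻¹ * (T * A * T - T * G - G * T + T * A * T)).trace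
      = 2 * ((T * A).trace - G.trace) := by
    have : T⁻¹ * (T * A * T - T * G - G * T + T * A * T)
        = (T⁻¹ * T) * (A * T) - (T⁻¹ * T) * G - T⁻¹ * (G * T) + (T⁻¹ * T) * (A * T) := by
      noncomm_ring
    rw [this, inv_mul_of_posDef hT, Matrix.trace_add, Matrix.trace_sub, Matrix.trace_sub,
      Matrix.trace_mul_comm T⁻¹, mul_assoc G, mul_inv_of_posDef hT, mul_one, one_mul, one_mul,
      Matrix.trace_mul_comm A]
    ring
  rw [e2] at h2
  have h3 := (Complex.le_def.mp h2).1
  simp at h3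
  exact h3

theorem re_trace_real_smul (c : ℝ) (P : Matrix (Fin n) (Fin n) ℂ) :
    (c • P).trace.re = c * P.trace.re := by
  rw [Matrix.trace_smul, Complex.smul_re, smul_eq_mul]

/-- The expression `(a + bT) A (a + bT)`, expanded. -/
theorem conj_weighted (a b : ℝ) (A T : Matrix (Fin n) (Fin n) ℂ) :
    (a • 1 + b • T) * A * (a • 1 + b • T) =
      a ^ 2 • A + b ^ 2 • (T * A * T) + (a * b) • (A * T + T * A) := by
  simp only [add_mul, mul_add, smul_mul_assoc, mul_smul_comm, one_mul, mul_one, smul_add,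
    smul_smul, pow_two, mul_comm b a, mul_assoc]
  abel

theorem re_trace_heron_le {A T : Matrix (Fin n) (Fin n) ℂ} (hA : A.PosDef) (hT : T.PosDef)
    {a b : ℝ} (ha : 0 ≤ a) (hb : 0 ≤ b) :
    (heron a b A (T * A * T)).trace.re ≤
      ((a • 1 + b • T) * A * (a • 1 + b • T)).trace.re := by
  have h := trace_geometricMean_le hA hT
  rw [conj_weighted, heron]
  simp only [Matrix.trace_add, Complex.add_re, re_trace_real_smul, Matrix.trace_mul_comm A T]
  nlinarith [mul_nonneg ha hb]

/-! ### The Wasserstein expression as a congruence, and the comparison -/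

/-- With `T = A⁻¹ # B`, one has `W_{a,b}(A,B) = (a + bT) A (a + bT)` and `B = T A T`. -/
theorem exists_wasserstein_eq {A B : Matrix (Fin n) (Fin n) ℂ} (hA : A.PosDef) (hB : B.PosDef)
    (a b : ℝ) : ∃ T : Matrix (Fin n) (Fin n) ℂ, T.PosDef ∧ T * A * T = B ∧
      wasserstein a b A B = (a • 1 + b • T) * A * (a • 1 + b • T) := by
  have hT := posDef_geometricMean hA.inv hB
  have hR := geometricMean_mul_inv_mul hA.inv hB
  rw [Matrix.nonsing_inv_nonsing_inv A ((Matrix.isUnit_iff_isUnit_det A).mp hA.isUnit)] at hR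
  generalize geometricMean A⁻¹ B = T at *
  -- `PQ` is similar to the positive definite `P^{1/2} Q P^{1/2}`. Hence `AT` and `TA`, whose
  -- squares are `AB` and `BA`, are the principal roots.
  have hspec : ∀ P Q : Matrix (Fin n) (Fin n) ℂ, P.PosDef → Q.PosDef →
      ∀ z ∈ spectrum ℂ (P * Q), 0 < z.re := by
    intro P Q hP hQ z hz
    obtain ⟨u, hu⟩ := (posDef_sqrt hP).isUnit
    have hC := posDef_conj hQ (posDef_sqrt hP)
    have e : P * Q = u * (CFC.sqrt P * Q * CFC.sqrt P) *
        ((u⁻¹ : (Matrix (Fin n) (Fin n) ℂ)ˣ) : Matrix (Fin n) (Fin n) ℂ) := by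
      nth_rw 1 [← sqrt_mul_sqrt hP]
      rw [← hu]
      simp [mul_assoc]
    rw [e, spectrum.units_conjugate, hC.isHermitian.spectrum_eq_image_range] at hz
    obtain ⟨_, ⟨i, rfl⟩, rfl⟩ := hz
    simpa using hC.eigenvalues_pos i
  have h1 : principalSqrt (A * B) = A * T :=
    (isPrincipalSqrt_principalSqrt_mul hA hB).unique
      ⟨by rw [← hR]; simp only [mul_assoc], hspec A T hA hT⟩
  have h2 : principalSqrt (B * A) = T * A :=
    (isPrincipalSqrt_principalSqrt_mul hB hA).unique
      ⟨by rw [← hR]; simp only [mul_assoc], hspec T A hT hA⟩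
  refine ⟨T, hT, hR, ?_⟩
  rw [conj_weighted, wasserstein, h1, h2, hR]

theorem posDef_weight {T : Matrix (Fin n) (Fin n) ℂ} (hT : T.PosDef) {a b : ℝ} (ha : 0 ≤ a)
    (hb : 0 ≤ b) (hab : 0 < a + b) : (a • 1 + b • T : Matrix (Fin n) (Fin n) ℂ).PosDef := by
  rcases ha.eq_or_lt with rfl | ha
  · rw [zero_smul, zero_add]
    exact hT.smul (by linarith)
  · exact (Matrix.PosDef.one.smul ha).add_posSemidef (hT.posSemidef.smul hb)

/-- Main comparison: every positive definite `X ≥ W`, `X ≥ t` dominates the Heron expression by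
a matrix `Y ≥ t` of trace at most that of `X`. -/
theorem exists_ge_heron {A T : Matrix (Fin n) (Fin n) ℂ} (hA : A.PosDef) (hT : T.PosDef)
    {a b : ℝ} (ha : 0 ≤ a) (hb : 0 ≤ b) (hab : 0 < a + b) {t : ℝ} (ht : 0 < t)
    {X : Matrix (Fin n) (Fin n) ℂ} (htX : t • 1 ≤ X)
    (hX : (a • 1 + b • T) * A * (a • 1 + b • T) ≤ X) :
    ∃ Y : Matrix (Fin n) (Fin n) ℂ, heron a b A (T * A * T) ≤ Y ∧ t • 1 ≤ Y ∧
      Y.trace.re ≤ X.trace.re := by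
  have hM := posDef_weight hT ha hb hab
  have hMT : (a • 1 + b • T : Matrix (Fin n) (Fin n) ℂ) * T = T * (a • 1 + b • T) := by
    simp [add_mul, mul_add]
  have hcw := fun Z => conj_weighted a b Z T
  have htr := fun Z : Matrix (Fin n) (Fin n) ℂ => fun hZ : Z.PosDef =>
    re_trace_heron_le hZ hT ha hb
  generalize hMdef : (a • 1 + b • T : Matrix (Fin n) (Fin n) ℂ) = M at *
  have h1 := mul_inv_of_posDef hM
  have h2 := inv_mul_of_posDef hM
  have hK := hM.inv
  have hKT : M⁻¹ * T = T * M⁻¹ := by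
    calc _ = M⁻¹ * (T * M) * M⁻¹ := by rw [mul_assoc, mul_assoc, h1, mul_one]
      _ = (M⁻¹ * M) * (T * M⁻¹) := by rw [← hMT]; simp only [mul_assoc]
      _ = _ := by rw [h2, one_mul]
  generalize M⁻¹ = K at *
  have ht1 : (t • 1 : Matrix (Fin n) (Fin n) ℂ).PosDef := Matrix.PosDef.one.smul ht
  have hXP : X.PosDef := by
    have := ht1.add_posSemidef (Matrix.le_iff.mp htX)
    rwa [add_sub_cancel] at this
  have e : ∀ Z : Matrix (Fin n) (Fin n) ℂ, K * (M * Z * M) * K = Z := fun Z => by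
    calc _ = (K * M) * Z * (M * K) := by simp only [mul_assoc]
      _ = Z := by rw [h1, h2, one_mul, mul_one]
  have hmono : ∀ P : Matrix (Fin n) (Fin n) ℂ, P.PosDef → P ≤ X →
      heron a b (K * P * K) (T * (K * P * K) * T) ≤
        heron a b (K * X * K) (T * (K * X * K) * T) := fun P hP h => by
    have h' := conj_le_conj h hK.isHermitian
    exact heron_mono (posDef_conj hP hK) (posDef_conj hXP hK) (posDef_conj (posDef_conj hP hK) hT)
      (posDef_conj (posDef_conj hXP hK) hT) h' (conj_le_conj h' hT.isHermitian) ha hb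
  -- The witness is `Φ(X)`, where `K = M⁻¹`.
  refine ⟨heron a b (K * X * K) (T * (K * X * K) * T), ?_, ?_, ?_⟩
  · have := hmono _ (posDef_conj hA hM) hX
    rwa [e] at this
  -- `Φ(t) = t`: the matrix `A1 = tK²` commutes with `T`, so the mean of `A1` and `T A1 T` is `T
  -- A1`, and the Heron expression collapses to `M A1 M = t`.
  · refine le_trans (le_of_eq ?_) (hmono _ ht1 htX)
    have hA1 := posDef_conj ht1 hK
    have hc : K * (t • 1) * K * T = T * (K * (t • 1) * K) := by
      simp only [mul_smul_comm, smul_mul_assoc, mul_one]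
      rw [mul_assoc K, hKT, ← mul_assoc, hKT, mul_assoc]
    have hG : (T * (K * (t • 1) * K)).PosDef := by
      have := (posDef_conj hT hK).smul ht
      convert this using 1
      simp only [mul_smul_comm, smul_mul_assoc, mul_one]
      rw [hKT, mul_assoc]
    have hMA : M * (K * (t • 1) * K) * M = t • 1 := by
      calc _ = (M * K) * (t • 1) * (K * M) := by simp only [mul_assoc]
        _ = t • 1 := by rw [h1, h2, one_mul, mul_one]
    generalize K * (t • 1) * K = A1 at *
    rw [heron, eq_geometricMean_of_riccati hA1 (posDef_conj hA1 hT) hG, ← hMA, hcw, hc,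
      ← two_smul ℝ, smul_smul]
    · congr 2
      ring
    · rw [mul_assoc T, mul_inv_of_posDef hA1, mul_one, ← hc, ← mul_assoc, hc]
  · refine (htr _ (posDef_conj hXP hK)).trans_eq ?_
    congr 2
    calc _ = (M * K) * X * (K * M) := by simp only [mul_assoc]
      _ = X := by rw [h1, h2, one_mul, mul_one]

/-! ### Ordered eigenvalues and weak majorization -/

theorem decreasingRearrangement_eq_self {x : Fin n → ℝ} (hx : Antitone x) :
    decreasingRearrangement x = x := by
  have : Tuple.sort (fun i => -x i) = Equiv.refl _ :=
    Tuple.sort_eq_refl_iff_monotone.mpr fun _ _ h => neg_le_neg (hx h)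
  rw [decreasingRearrangement, this]
  rfl

theorem eigenvalueVector_antitone {T : Matrix (Fin n) (Fin n) ℂ} (hT : T.IsHermitian) :
    Antitone (eigenvalueVector hT) := fun _ _ h => hT.eigenvalues₀_antitone h

theorem weaklyMajorizedBy_eigenvalueVector_iff {S T : Matrix (Fin n) (Fin n) ℂ}
    (hS : S.IsHermitian) (hT : T.IsHermitian) :
    WeaklyMajorizedBy (eigenvalueVector hS) (eigenvalueVector hT) ↔
      ∀ k : ℕ, 1 ≤ k → k ≤ n → ∑ j : Fin n with j.val < k, eigenvalueVector hS j ≤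
        ∑ j : Fin n with j.val < k, eigenvalueVector hT j := by
  rw [WeaklyMajorizedBy, decreasingRearrangement_eq_self (eigenvalueVector_antitone hS),
    decreasingRearrangement_eq_self (eigenvalueVector_antitone hT)]

/-- The spectral theorem, with the eigenvalues in decreasing order. -/
theorem exists_unitary_eigenvalueVector {T : Matrix (Fin n) (Fin n) ℂ} (hT : T.IsHermitian) :
    ∃ U ∈ Matrix.unitaryGroup (Fin n) ℂ,
      T = U * diagonal (fun j => (eigenvalueVector hT j : ℂ)) * Uᴴ := by
  -- `eigenvalues` is `eigenvalues₀` reindexed along an unspecified equivalence; `e` restores the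
  -- decreasing order.
  let e : Fin n ≃ Fin n := (finCongr (Fintype.card_fin n).symm).trans
    (Fintype.equivOfCardEq (Fintype.card_fin _))
  have he : ∀ j, hT.eigenvalues (e j) = eigenvalueVector hT j := fun j => by
    simp [e, Matrix.IsHermitian.eigenvalues, eigenvalueVector]
  let V : Matrix (Fin n) (Fin n) ℂ := hT.eigenvectorUnitary
  have hV : V * Vᴴ = 1 := Matrix.mem_unitaryGroup_iff.mp hT.eigenvectorUnitary.2
  have hspec := hT.spectral_theorem
  rw [Unitary.conjStarAlgAut_apply] at hspec
  refine ⟨V.submatrix id e, Matrix.mem_unitaryGroup_iff.mpr ?_, ?_⟩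
  · rw [Matrix.star_eq_conjTranspose, Matrix.conjTranspose_submatrix,
      Matrix.submatrix_mul_equiv, hV, Matrix.submatrix_id_id]
  · have hd : diagonal (fun j => (eigenvalueVector hT j : ℂ)) =
        (diagonal (RCLike.ofReal ∘ hT.eigenvalues : Fin n → ℂ)).submatrix e e := by
      rw [Matrix.submatrix_diagonal_equiv]
      congr 1
      funext j
      simp [he]
    rw [hd, Matrix.conjTranspose_submatrix, Matrix.submatrix_mul_equiv,
      Matrix.submatrix_mul_equiv, Matrix.submatrix_id_id]
    exact hspec

theorem unitary_conj_le {U : Matrix (Fin n) (Fin n) ℂ} {x y : Fin n → ℝ} (h : x ≤ y) :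
    U * diagonal (fun j => (x j : ℂ)) * Uᴴ ≤ U * diagonal (fun j => (y j : ℂ)) * Uᴴ := by
  rw [Matrix.le_iff, ← sub_mul, ← mul_sub, Matrix.diagonal_sub]
  refine (Matrix.PosSemidef.diagonal ?_).mul_mul_conjTranspose_same U
  intro j
  simpa [← Complex.ofReal_sub] using h j

theorem re_trace_unitary_conj {U : Matrix (Fin n) (Fin n) ℂ}
    (hU : U ∈ Matrix.unitaryGroup (Fin n) ℂ) (x : Fin n → ℝ) :
    (U * diagonal (fun j => (x j : ℂ)) * Uᴴ).trace.re = ∑ j, x j := by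
  rw [mul_assoc, Matrix.trace_mul_comm, mul_assoc, ← Matrix.star_eq_conjTranspose,
    Matrix.mem_unitaryGroup_iff'.mp hU, mul_one, Matrix.trace_diagonal, Complex.re_sum]
  simp

/-- If `H ≤ Y` and `t ≤ Y`, the sum of any `k` eigenvalues of `H` is at most
`tr Y - (n - k) t`. -/
theorem sum_eigenvalueVector_le {H Y : Matrix (Fin n) (Fin n) ℂ} (hH : H.IsHermitian)
    (hHY : H ≤ Y) {t : ℝ} (ht : t • 1 ≤ Y) (s : Finset (Fin n)) :
    ∑ j ∈ s, eigenvalueVector hH j ≤ Y.trace.re - ∑ _j ∈ sᶜ, t := by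
  obtain ⟨U, hU, hHU⟩ := exists_unitary_eigenvalueVector hH
  have hUU := Matrix.mem_unitaryGroup_iff'.mp hU
  have hUU' := Matrix.mem_unitaryGroup_iff.mp hU
  rw [Matrix.star_eq_conjTranspose] at hUU hUU'
  have h1 := (Matrix.le_iff.mp hHY).conjTranspose_mul_mul_same U
  have h2 := (Matrix.le_iff.mp ht).conjTranspose_mul_mul_same U
  have e1 : Uᴴ * H * U = diagonal (fun j => (eigenvalueVector hH j : ℂ)) := by
    calc _ = Uᴴ * (U * diagonal (fun j => (eigenvalueVector hH j : ℂ)) * Uᴴ) * U := by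
          rw [← hHU]
      _ = (Uᴴ * U) * diagonal (fun j => (eigenvalueVector hH j : ℂ)) * (Uᴴ * U) := by
          simp only [mul_assoc]
      _ = _ := by rw [hUU, one_mul, mul_one]
  have e2 : Uᴴ * (t • 1) * U = t • 1 := by
    rw [mul_smul_comm, mul_one, smul_mul_assoc, hUU]
  have e3 : (Uᴴ * Y * U).trace = Y.trace := by
    rw [mul_assoc, Matrix.trace_mul_comm, mul_assoc, hUU', mul_one]
  rw [mul_sub, sub_mul, e1] at h1
  rw [mul_sub, sub_mul, e2] at h2
  -- In an eigenbasis of `H`, each diagonal entry of `Y` dominates both the eigenvalue of `H` and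
  -- `t`; the first bound serves on `s`, the second off `s`.
  have d1 : ∀ j, eigenvalueVector hH j ≤ ((Uᴴ * Y * U) j j).re := fun j => by
    have := (Complex.le_def.mp (h1.diag_nonneg (i := j))).1
    simpa using this
  have d2 : ∀ j, t ≤ ((Uᴴ * Y * U) j j).re := fun j => by
    have := (Complex.le_def.mp (h2.diag_nonneg (i := j))).1
    simpa using this
  rw [← e3, Matrix.trace, Complex.re_sum, ← Finset.sum_add_sum_compl s]
  have := Finset.sum_le_sum fun j (_ : j ∈ s) => d1 j
  have := Finset.sum_le_sum fun j (_ : j ∈ sᶜ) => d2 j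
  simp only [Matrix.diag_apply]
  linarith

theorem eigenvalueVector_pos {T : Matrix (Fin n) (Fin n) ℂ} (hT : T.PosDef) (j : Fin n) :
    0 < eigenvalueVector hT.isHermitian j := by
  have := hT.eigenvalues_pos ((Fintype.equivOfCardEq (Fintype.card_fin _))
    (Fin.cast (Fintype.card_fin n).symm j))
  simpa [Matrix.IsHermitian.eigenvalues, eigenvalueVector] using this

theorem isHermitian_wasserstein {A B : Matrix (Fin n) (Fin n) ℂ} (hA : A.PosDef) (hB : B.PosDef)
    (a b : ℝ) : (wasserstein a b A B).IsHermitian := by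
  obtain ⟨T, hT, -, hW⟩ := exists_wasserstein_eq hA hB a b
  have hM : (a • 1 + b • T : Matrix (Fin n) (Fin n) ℂ).IsHermitian :=
    (isHermitian_real_smul Matrix.isHermitian_one a).add (isHermitian_real_smul hT.isHermitian b)
  rw [hW]
  nth_rw 2 [← hM.eq]
  exact Matrix.isHermitian_mul_mul_conjTranspose _ hA.isHermitian

theorem posDef_wasserstein {A B : Matrix (Fin n) (Fin n) ℂ} (hA : A.PosDef) (hB : B.PosDef)
    {a b : ℝ} (ha : 0 ≤ a) (hb : 0 ≤ b) (hab : 0 < a + b) : (wasserstein a b A B).PosDef := by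
  obtain ⟨T, hT, -, hW⟩ := exists_wasserstein_eq hA hB a b
  rw [hW]
  exact posDef_conj hA (posDef_weight hT ha hb hab)

/-- The eigenvalues of the Heron expression are weakly majorized by those of the
Bures-Wasserstein expression. -/
theorem weaklyMajorizedBy_heron_wasserstein {A B : Matrix (Fin n) (Fin n) ℂ} (hA : A.PosDef)
    (hB : B.PosDef) {a b : ℝ} (ha : 0 ≤ a) (hb : 0 ≤ b) (hab : 0 < a + b) :
    WeaklyMajorizedBy (eigenvalueVector (isHermitian_heron hA hB a b))
      (eigenvalueVector (isHermitian_wasserstein hA hB a b)) := by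
  rw [weaklyMajorizedBy_eigenvalueVector_iff]
  intro k hk hkn
  have hanti := eigenvalueVector_antitone (isHermitian_wasserstein hA hB a b)
  have hpos := eigenvalueVector_pos (posDef_wasserstein hA hB ha hb hab)
  obtain ⟨U, hU, hWU⟩ := exists_unitary_eigenvalueVector (isHermitian_wasserstein hA hB a b)
  set x := eigenvalueVector (isHermitian_wasserstein hA hB a b)
  obtain ⟨T, hT, rfl, hW⟩ := exists_wasserstein_eq hA hB a b
  -- Indices start at `0`, so this is the position of the `k`-th largest eigenvalue.
  set i : Fin n := ⟨k - 1, by omega⟩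
  set t := x i
  set X := U * diagonal (fun j => ((max (x j) t : ℝ) : ℂ)) * Uᴴ with hX
  have hWX : (a • 1 + b • T) * A * (a • 1 + b • T) ≤ X := by
    rw [← hW, hWU]
    exact unitary_conj_le fun _ => le_max_left _ _
  have htX : t • 1 ≤ X := by
    refine le_trans (le_of_eq ?_) (unitary_conj_le (x := fun _ => t) fun _ => le_max_right _ _)
    have : diagonal (fun _ : Fin n => (t : ℂ)) = t • 1 := by
      ext p q
      simp [Matrix.diagonal_apply, Matrix.one_apply]
    rw [this, mul_smul_comm, mul_one, smul_mul_assoc, ← Matrix.star_eq_conjTranspose,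
      Matrix.mem_unitaryGroup_iff.mp hU]
  obtain ⟨Y, hHY, htY, htr⟩ := exists_ge_heron hA hT ha hb hab (hpos i) htX hWX
  rw [hX, re_trace_unitary_conj hU] at htr
  refine (sum_eigenvalueVector_le _ hHY htY _).trans ?_
  rw [sub_le_iff_le_add]
  refine htr.trans_eq ?_
  rw [← Finset.sum_add_sum_compl (Finset.univ.filter fun j : Fin n => j.val < k)]
  congr 1
  · refine Finset.sum_congr rfl fun j hj => max_eq_left (hanti ?_)
    have := (Finset.mem_filter.mp hj).2
    exact Fin.le_def.mpr (by simp only [i]; omega)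
  · refine Finset.sum_congr rfl fun j hj => max_eq_right (hanti ?_)
    have : ¬ j.val < k := by simpa using hj
    exact Fin.le_def.mpr (by simp only [i]; omega)

/-! ### Symmetric gauge functions -/

/-- Abel summation: a sequence with nonnegative partial sums, weighted by an antitone sequence. -/
theorem mul_sum_range_le_sum_mul {d z : ℕ → ℝ} {m : ℕ}
    (hd : ∀ i, i + 1 < m → d (i + 1) ≤ d i)
    (hz : ∀ k, k ≤ m → 0 ≤ ∑ i ∈ Finset.range k, z i) :
    ∀ k, k + 1 ≤ m →
      d k * ∑ i ∈ Finset.range (k + 1), z i ≤ ∑ i ∈ Finset.range (k + 1), d i * z i := by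
  intro k
  induction k with
  | zero => intro _; simp
  | succ k ih =>
    intro hk
    rw [Finset.sum_range_succ, Finset.sum_range_succ (fun i => d i * z i), mul_add]
    have h1 := ih (by omega)
    have h2 := mul_le_mul_of_nonneg_right (hd k (by omega)) (hz (k + 1) (by omega))
    linarith

theorem sum_mul_le_sum_mul_of_partial_sums {d x y : Fin n → ℝ} (hd : Antitone d)
    (hd0 : ∀ j, 0 ≤ d j)
    (h : ∀ k : ℕ, 1 ≤ k → k ≤ n → ∑ j : Fin n with j.val < k, x j ≤
        ∑ j : Fin n with j.val < k, y j) :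
    ∑ j, d j * x j ≤ ∑ j, d j * y j := by
  rcases n with _ | m
  · simp
  let D : ℕ → ℝ := fun i => if h : i < m + 1 then d ⟨i, h⟩ else 0
  let z : ℕ → ℝ := fun i => if h : i < m + 1 then y ⟨i, h⟩ - x ⟨i, h⟩ else 0
  have hz : ∀ k, k ≤ m + 1 → 0 ≤ ∑ i ∈ Finset.range k, z i := by
    intro k hk
    rcases Nat.eq_zero_or_pos k with rfl | hk0
    · simp
    have h1 := h k hk0 hk
    rw [← sub_nonneg, ← Finset.sum_sub_distrib] at h1
    refine h1.trans_eq ?_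
    refine Finset.sum_bij (fun j _ => j.val) ?_ ?_ ?_ ?_
    · intro j hj
      simpa using hj
    · intro i _ j _ hij
      exact Fin.ext hij
    · intro i hi
      have hi' := Finset.mem_range.mp hi
      exact ⟨⟨i, by omega⟩, by simpa using hi', rfl⟩
    · intro j _
      simp only [z, dif_pos j.isLt]
  have hD : ∀ i, i + 1 < m + 1 → D (i + 1) ≤ D i := by
    intro i hi
    simp only [D, hi, (by omega : i < m + 1), dif_pos]
    exact hd (Fin.le_def.mpr (Nat.le_succ i))
  have h2 := mul_sum_range_le_sum_mul hD hz m le_rfl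
  -- The boundary term of the Abel summation; its sign needs the last weight to be nonnegative.
  have h3 : 0 ≤ D m * ∑ i ∈ Finset.range (m + 1), z i :=
    mul_nonneg (by simp [D, hd0]) (hz _ le_rfl)
  have h4 : ∑ i ∈ Finset.range (m + 1), D i * z i = ∑ j, d j * (y j - x j) := by
    rw [Finset.sum_range]
    exact Finset.sum_congr rfl fun j _ => by simp only [D, z, dif_pos j.isLt]
  rw [h4] at h2
  simp only [mul_sub, Finset.sum_sub_distrib] at h2
  linarith

/-- Hahn–Banach: extend `c • x ↦ c * p x` from the line through `x`, keeping it below `p`. -/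
theorem exists_linear_support (p : Seminorm ℝ (Fin n → ℝ)) (x : Fin n → ℝ) :
    ∃ f : (Fin n → ℝ) →ₗ[ℝ] ℝ, f x = p x ∧ ∀ y, f y ≤ p y := by
  rcases eq_or_ne x 0 with rfl | hx
  · exact ⟨0, by simp, fun y => by simp⟩
  obtain ⟨g, hg, hgp⟩ := exists_extension_of_le_sublinear
    (LinearPMap.mkSpanSingleton x (p x) hx) p
    (fun c hc y => by rw [map_smul_eq_mul, Real.norm_of_nonneg hc.le]) (map_add_le_add p) (by
      rintro ⟨y, hy⟩
      obtain ⟨c, rfl⟩ := Submodule.mem_span_singleton.mp hy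
      rw [LinearPMap.mkSpanSingleton'_apply, map_smul_eq_mul, smul_eq_mul]
      exact mul_le_mul_of_nonneg_right (Real.le_norm_self c) (apply_nonneg p x))
  refine ⟨g, ?_, hgp⟩
  have := hg ⟨x, Submodule.mem_span_singleton_self x⟩
  rwa [LinearPMap.mkSpanSingleton_apply] at this

/-- A symmetric gauge function is monotone under weak majorization of nonnegative decreasing
vectors. -/
theorem gauge_le_of_partial_sums (p : Seminorm ℝ (Fin n → ℝ))
    (hperm : ∀ (σ : Equiv.Perm (Fin n)) x, p (x ∘ σ) = p x)
    (hsign : ∀ (ε : Fin n → ℝ), (∀ j, ε j = 1 ∨ ε j = -1) → ∀ x, p (ε * x) = p x)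
    {x y : Fin n → ℝ} (hx : Antitone x) (hx0 : ∀ j, 0 ≤ x j)
    (h : ∀ k : ℕ, 1 ≤ k → k ≤ n → ∑ j : Fin n with j.val < k, x j ≤
        ∑ j : Fin n with j.val < k, y j) : p x ≤ p y := by
  obtain ⟨f, hfx, hfp⟩ := exists_linear_support p x
  have hf : ∀ v, f v = ∑ j, f (Pi.single j 1) * v j := fun v => by
    conv_lhs => rw [← Finset.univ_sum_single v, map_sum]
    refine Finset.sum_congr rfl fun j _ => ?_
    have : (Pi.single j (v j) : Fin n → ℝ) = v j • Pi.single j 1 := by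
      rw [← Pi.single_smul, smul_eq_mul, mul_one]
    rw [this, map_smul, smul_eq_mul, mul_comm]
  set c : Fin n → ℝ := fun j => f (Pi.single j 1)
  set σ := Tuple.sort fun j => -|c j|
  have hanti : Antitone fun j => |c (σ j)| := fun i j hij =>
    neg_le_neg_iff.mp (Tuple.monotone_sort (fun j => -|c j|) hij)
  -- With `|c|↓` the sorted `|c|`, the chain is `p x = ∑ c x ≤ ∑ |c| x ≤ ∑ |c|↓ x ≤ ∑ |c|↓ y`:
  -- signs, rearrangement, Abel summation. The last sum is `f` at a signed permutation of `y`, hence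
  -- at most `p y`.
  have h1 : p x ≤ ∑ j, |c j| * x j := by
    rw [← hfx, hf]
    exact Finset.sum_le_sum fun j _ => mul_le_mul_of_nonneg_right (le_abs_self _) (hx0 j)
  have h2 : ∑ j, |c j| * x j ≤ ∑ j, |c (σ j)| * x j := by
    have := (hanti.monovary hx).sum_comp_perm_mul_le_sum_mul (σ := σ⁻¹)
    simpa using this
  have h3 := sum_mul_le_sum_mul_of_partial_sums hanti (fun j => abs_nonneg _) h
  let ε : Fin n → ℝ := fun j => if 0 ≤ c j then 1 else -1
  have hε : ∀ j, |c j| = c j * ε j := fun j => by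
    by_cases hj : 0 ≤ c j
    · simp [ε, hj, abs_of_nonneg hj]
    · simp [ε, hj, abs_of_neg (not_le.mp hj)]
  have h4 : ∑ j, |c (σ j)| * y j = f (ε * (y ∘ σ.symm)) := by
    rw [hf, ← Equiv.sum_comp σ (fun j => f (Pi.single j 1) * _)]
    refine Finset.sum_congr rfl fun j _ => ?_
    rw [hε, Pi.mul_apply, Function.comp_apply, Equiv.symm_apply_apply, mul_assoc]
  have h5 : p (ε * (y ∘ σ.symm)) = p y := by
    rw [hsign ε (fun j => by by_cases hj : 0 ≤ c j <;> simp [ε, hj]), hperm]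
  linarith [hfp (ε * (y ∘ σ.symm))]

/-! ### Unitarily invariant norms and Ky Fan dominance -/

/-- The gauge function of a seminorm on matrices. -/
noncomputable def diagonalGauge (N : Seminorm ℂ (Matrix (Fin n) (Fin n) ℂ)) : Seminorm ℝ (Fin n → ℝ) :=
  Seminorm.of (fun x => N (diagonal fun j => (x j : ℂ)))
    (fun x y => by
      have : (diagonal fun j => ((x + y) j : ℂ)) =
          (diagonal fun j => (x j : ℂ)) + diagonal fun j => (y j : ℂ) := by
        rw [Matrix.diagonal_add]
        simp
      rw [this]
      exact map_add_le_add N _ _)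
    (fun c x => by
      have : (diagonal fun j => ((c • x) j : ℂ)) = (c : ℂ) • diagonal fun j => (x j : ℂ) := by
        rw [← Matrix.diagonal_smul]
        congr 1
        funext j
        simp
      rw [this, map_smul_eq_mul]
      simp)

theorem diagonalGauge_apply (N : Seminorm ℂ (Matrix (Fin n) (Fin n) ℂ)) (x : Fin n → ℝ) :
    diagonalGauge N x = N (diagonal fun j => (x j : ℂ)) := rfl

namespace IsUnitarilyInvariantNorm

variable {N : Seminorm ℂ (Matrix (Fin n) (Fin n) ℂ)}

theorem diagonalGauge_comp_perm (hN : IsUnitarilyInvariantNorm N) (σ : Equiv.Perm (Fin n))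
    (x : Fin n → ℝ) : diagonalGauge N (x ∘ σ) = diagonalGauge N x := by
  have hP : ∀ τ : Equiv.Perm (Fin n), (1 : Matrix (Fin n) (Fin n) ℂ).submatrix τ id ∈
      Matrix.unitaryGroup (Fin n) ℂ := fun τ => by
    rw [Matrix.mem_unitaryGroup_iff, Matrix.star_eq_conjTranspose,
      Matrix.conjTranspose_submatrix, Matrix.conjTranspose_one,
      ← Matrix.submatrix_mul _ _ _ _ _ Function.bijective_id, mul_one,
      Matrix.submatrix_one_equiv]
  have h := hN.map_unitary_mul_mul _ (hP σ) _ (Unitary.star_mem (hP σ)) (diagonal fun j => (x j : ℂ))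
  rw [diagonalGauge_apply, diagonalGauge_apply, ← h]
  congr 1
  rw [Matrix.star_eq_conjTranspose, Matrix.conjTranspose_submatrix, Matrix.conjTranspose_one]
  rw [← Matrix.submatrix_id_id (diagonal fun j => (x j : ℂ))]
  rw [← Matrix.submatrix_mul _ _ _ _ _ Function.bijective_id,
    ← Matrix.submatrix_mul _ _ _ _ _ Function.bijective_id, one_mul, mul_one,
    Matrix.submatrix_diagonal_equiv]
  rfl

theorem diagonalGauge_mul_sign (hN : IsUnitarilyInvariantNorm N) {ε : Fin n → ℝ}
    (hε : ∀ j, ε j = 1 ∨ ε j = -1) (x : Fin n → ℝ) :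
    diagonalGauge N (ε * x) = diagonalGauge N x := by
  have hD : (diagonal fun j => (ε j : ℂ)) ∈ Matrix.unitaryGroup (Fin n) ℂ := by
    rw [Matrix.mem_unitaryGroup_iff, Matrix.star_eq_conjTranspose,
      Matrix.diagonal_conjTranspose, Matrix.diagonal_mul_diagonal, ← Matrix.diagonal_one]
    congr 1
    funext j
    rcases hε j with h | h <;> simp [h]
  have h := hN.map_unitary_mul_mul _ hD 1 (one_mem _) (diagonal fun j => (x j : ℂ))
  rw [mul_one, Matrix.diagonal_mul_diagonal] at h
  rw [diagonalGauge_apply, diagonalGauge_apply, ← h]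
  simp

/-- The norm of a Hermitian matrix is the gauge of its eigenvalues. -/
theorem eq_diagonalGauge (hN : IsUnitarilyInvariantNorm N) {T : Matrix (Fin n) (Fin n) ℂ}
    (hT : T.IsHermitian) : N T = diagonalGauge N (eigenvalueVector hT) := by
  obtain ⟨U, hU, hTU⟩ := exists_unitary_eigenvalueVector hT
  rw [diagonalGauge_apply]
  conv_lhs => rw [hTU]
  exact hN.map_unitary_mul_mul U hU Uᴴ (Unitary.star_mem hU) _

/-- Ky Fan dominance for a positive definite matrix and a Hermitian matrix. -/
theorem le_of_weaklyMajorizedBy (hN : IsUnitarilyInvariantNorm N)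
    {S T : Matrix (Fin n) (Fin n) ℂ} (hS : S.PosDef) (hT : T.IsHermitian)
    (h : WeaklyMajorizedBy (eigenvalueVector hS.isHermitian) (eigenvalueVector hT)) :
    N S ≤ N T := by
  rw [hN.eq_diagonalGauge hS.isHermitian, hN.eq_diagonalGauge hT]
  exact gauge_le_of_partial_sums _ hN.diagonalGauge_comp_perm
    (fun _ hε => hN.diagonalGauge_mul_sign hε) (eigenvalueVector_antitone _)
    (fun j => (eigenvalueVector_pos hS j).le)
    ((weaklyMajorizedBy_eigenvalueVector_iff _ _).mp h)

end IsUnitarilyInvariantNorm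

/-- Supplies the nonnegative eigenvalues that the gauge comparison requires on the smaller side. -/
theorem posDef_heron {A B : Matrix (Fin n) (Fin n) ℂ} (hA : A.PosDef) (hB : B.PosDef)
    {a b : ℝ} (ha : 0 ≤ a) (hb : 0 ≤ b) (hab : 0 < a + b) : (heron a b A B).PosDef := by
  have hG := (posDef_geometricMean hA hB).posSemidef.smul (by positivity : 0 ≤ 2 * a * b)
  refine Matrix.PosDef.add_posSemidef ?_ hG
  rcases ha.eq_or_lt with rfl | ha
  · have hb : 0 < b := by linarith
    rw [zero_pow two_ne_zero, zero_smul, zero_add]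
    exact hB.smul (by positivity : 0 < b ^ 2)
  · exact (hA.smul (by positivity : 0 < a ^ 2)).add_posSemidef
      (hB.posSemidef.smul (by positivity : 0 ≤ b ^ 2))

end HeronWasserstein

theorem mainTheorem3 (n : ℕ) (A B : Matrix (Fin n) (Fin n) ℂ) (hA : A.PosDef) (hB : B.PosDef)
    (a b : ℝ) (ha : 0 ≤ a) (hb : 0 ≤ b) :
    (∃ (hH : (HeronWasserstein.heron a b A B).IsHermitian)
        (hW : (HeronWasserstein.wasserstein a b A B).IsHermitian),
      HeronWasserstein.WeaklyMajorizedBy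
        (HeronWasserstein.eigenvalueVector hH) (HeronWasserstein.eigenvalueVector hW)) ∧
    (∀ N : Seminorm ℂ (Matrix (Fin n) (Fin n) ℂ), HeronWasserstein.IsUnitarilyInvariantNorm N →
      N (HeronWasserstein.heron a b A B) ≤ N (HeronWasserstein.wasserstein a b A B)) := by
  have hH := HeronWasserstein.isHermitian_heron hA hB a b
  have hW := HeronWasserstein.isHermitian_wasserstein hA hB a b
  rcases (add_nonneg ha hb).eq_or_lt with hab | hab
  -- For `a = b = 0` the weight `M` is not invertible in general, but both expressions vanish.
  · obtain rfl : a = 0 := by linarith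
    obtain rfl : b = 0 := by linarith
    have e : HeronWasserstein.heron 0 0 A B = HeronWasserstein.wasserstein 0 0 A B := by
      simp [HeronWasserstein.heron, HeronWasserstein.wasserstein]
    refine ⟨⟨hH, hW, ?_⟩, fun N _ => by rw [e]⟩
    revert hH
    rw [e]
    exact fun _ _ _ _ => le_rfl
  · have h := HeronWasserstein.weaklyMajorizedBy_heron_wasserstein hA hB ha hb hab
    exact ⟨⟨hH, hW, h⟩, fun N hN =>
      hN.le_of_weaklyMajorizedBy (HeronWasserstein.posDef_heron hA hB ha hb hab) hW h⟩
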